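/- **Theorem 3.12.** Let $\mathcal A'$, $\mathcal A$, $\mathcal A''$ be abelian categories, each with enough projective and enough injective objects, and let $$(\mathcal A',\mathcal A,\mathcal A'',i^*,i_*,i^!,j_!,j^*,j_*)$$ be a recollement; that is, $i_*:\mathcal A'\to\mathcal A$, $i^*,i^!:\mathcal A\to\mathcal A'$, $j^*:\mathcal A\to\mathcal A''$ and $j_!,j_*:\mathcal A''\to\mathcal A$ are functors such that $(i^*,i_*)$, $(i_*,i^!)$, $(j_!,j^*)$, $(j^*,j_*)$ are adjoint pairs, $i_*$, $j_!$, $j_*$ are fully faithful, and the objects $X$ of $\mathcal A$ with $j^*X=0$ are exactly those isomorphic to $i_*Y$ for some $Y\in\mathcal A'$. Assume that the recollement satisfies condition (P): for every projective object $P$ of $\mathcal A$ the counit $\varepsilon_P:j_!j^*P\to P$ of the adjoint pair $(j_!,j^*)$ is a monomorphism. For a class $\mathcal C$ of objects in an abelian category put $\mathcal C^\perp=\{X\mid \operatorname{Ext}^1(C,X)=0 \text{ for all } C\in\mathcal C\}$ and ${}^\perp\mathcal C=\{X\mid \operatorname{Ext}^1(X,C)=0 \text{ for all } C\in\mathcal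 C\}$. A pair $(\mathcal C,\mathcal D)$ of classes of objects is a *cotorsion pair* if $\mathcal C^\perp=\mathcal D$ and ${}^\perp\mathcal D=\mathcal C$. It is *complete* if for every object $M$ there are short exact sequences $0\to D_1\to C_1\to M\to 0$ and $0\to M\to D_2\to C_2\to 0$ with $C_1,C_2\in\mathcal C$ and $D_1,D_2\in\mathcal D$. It is *hereditary* if $\mathcal C$ is closed under kernels of epimorphisms (between objects of $\mathcal C$) and $\mathcal D$ is closed under cokernels of monomorphisms (between objects of $\mathcal D$). Let $(\mathcal U',\mathcal V')$ and $(\mathcal U'',\mathcal V'')$ be complete hereditary cotorsion pairs in $\mathcal A'$ and $\mathcal A''$, respectively. Assume that the first left derived functor of $j_!$ satisfies $(\mathbb L_1 j_!)(U)=0$ for all $U\in\mathcal U''$ and that the first right derived functor of $j_*$ satisfies $(\mathbb R_1 j_*)(V)=0$ for all $V\in\mathcal V''$. Put $$\mathcal M^{\mathcal U'}_{\mathcal U''}=\{X\in\mathcal A\mid i^*X\in\mathcal U',\ j^*X\in\mathcal U'',\ (\mathbb L_1 i^*)(X)=0\},$$ $$\mathcal N^{\mathcal V'}_{\mathcal V''}=\{X\in\mathcal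 A\mid i^!X\in\mathcal V',\ j^*X\in\mathcal V'',\ (\mathbb R_1 i^!)(X)=0\}.$$ Then $(\mathcal M^{\mathcal U'}_{\mathcal U''},\mathcal N^{\mathcal V'}_{\mathcal V''})$ is a complete hereditary cotorsion pair in $\mathcal A$. -/

import Mathlib

open CategoryTheory CategoryTheory.Limits

universe v₁ v₂ v₃ u₁ u₂ u₃ v u

namespace RecollementGluing

section CotorsionPairs

variable {C : Type u} [Category.{v} C] [Abelian C]

/-- `Ext¹(X, Y) = 0`. Mathlib's `Ext` is formed in the universe in which it always exists
(`HasExt.standard`), so that no smallness assumption is needed. -/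
def Ext1Vanishes (X Y : C) : Prop :=
  letI : HasExt.{max u v} C := HasExt.standard C
  Subsingleton (Abelian.Ext.{max u v} X Y 1)

/-- The class `𝒰^⊥` of all `Y` with `Ext¹(X, Y) = 0` for all `X ∈ 𝒰`. -/
def rightPerp (U : ObjectProperty C) : ObjectProperty C :=
  fun Y => ∀ X : C, U X → Ext1Vanishes X Y

/-- The class `^⊥𝒱` of all `X` with `Ext¹(X, Y) = 0` for all `Y ∈ 𝒱`. -/
def leftPerp (V : ObjectProperty C) : ObjectProperty C :=
  fun X => ∀ Y : C, V Y → Ext1Vanishes X Y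

/-- `(𝒰, 𝒱)` is a cotorsion pair: `𝒰^⊥ = 𝒱` and `^⊥𝒱 = 𝒰`. -/
structure IsCotorsionPair (U V : ObjectProperty C) : Prop where
  rightPerp_eq : rightPerp U = V
  leftPerp_eq : leftPerp V = U

/-- A cotorsion pair `(𝒰, 𝒱)` is complete if every object `M` fits into short exact sequences
`0 ⟶ V₁ ⟶ U₁ ⟶ M ⟶ 0` and `0 ⟶ M ⟶ V₂ ⟶ U₂ ⟶ 0` with `Uᵢ ∈ 𝒰` and `Vᵢ ∈ 𝒱`. It is hereditary
if `𝒰` is closed under kernels of epimorphisms and `𝒱` is closed under cokernels of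
monomorphisms. -/
structure IsCompleteHereditaryCotorsionPair (U V : ObjectProperty C) : Prop
    extends IsCotorsionPair U V where
  exists_left : ∀ M : C, ∃ (V₁ U₁ : C) (f : V₁ ⟶ U₁) (g : U₁ ⟶ M) (w : f ≫ g = 0),
    (ShortComplex.mk f g w).ShortExact ∧ U U₁ ∧ V V₁
  exists_right : ∀ M : C, ∃ (V₂ U₂ : C) (f : M ⟶ V₂) (g : V₂ ⟶ U₂) (w : f ≫ g = 0),
    (ShortComplex.mk f g w).ShortExact ∧ U U₂ ∧ V V₂
  kernel_mem : ∀ S : ShortComplex C, S.ShortExact → U S.X₂ → U S.X₃ → U S.X₁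
  cokernel_mem : ∀ S : ShortComplex C, S.ShortExact → V S.X₁ → V S.X₂ → V S.X₃

end CotorsionPairs

/-- A recollement of the abelian category `A` relative to the abelian categories `A'` and `A''`.
The six functors are `iPull = i^*`, `iPush = i_*`, `iShriek = i^!`, `jShriek = j_!`,
`jPull = j^*` and `jPush = j_*`. -/
structure Recollement (A' : Type u₁) [Category.{v₁} A'] [Abelian A']
    (A : Type u₂) [Category.{v₂} A] [Abelian A]
    (A'' : Type u₃) [Category.{v₃} A''] [Abelian A''] where
  iPull : A ⥤ A'
  iPush : A' ⥤ A
  iShriek : A ⥤ A'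
  jShriek : A'' ⥤ A
  jPull : A ⥤ A''
  jPush : A'' ⥤ A
  /-- `i^* ⊣ i_*` -/
  iAdj : iPull ⊣ iPush
  /-- `i_* ⊣ i^!` -/
  iAdj' : iPush ⊣ iShriek
  /-- `j_! ⊣ j^*` -/
  jAdj : jShriek ⊣ jPull
  /-- `j^* ⊣ j_*` -/
  jAdj' : jPull ⊣ jPush
  iPush_full : iPush.Full
  iPush_faithful : iPush.Faithful
  jShriek_full : jShriek.Full
  jShriek_faithful : jShriek.Faithful
  jPush_full : jPush.Full
  jPush_faithful : jPush.Faithful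
  /-- `Ker j^* = Im i_*`, the image being closed under isomorphisms. -/
  kernel_eq : jPull.kernel = iPush.essImage

/-- A functor between abelian categories that has a left adjoint is additive. -/
theorem additive_of_rightAdjoint {A : Type u₁} [Category.{v₁} A] [Abelian A]
    {B : Type u₂} [Category.{v₂} B] [Abelian B] {F : A ⥤ B} {G : B ⥤ A} (adj : F ⊣ G) :
    G.Additive := by
  have : PreservesLimitsOfSize.{0, 0} G := adj.rightAdjoint_preservesLimits
  exact Functor.additive_of_preserves_binary_products G

namespace Recollement

variable {A' : Type u₁} [Category.{v₁} A'] [Abelian A']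
  {A : Type u₂} [Category.{v₂} A] [Abelian A]
  {A'' : Type u₃} [Category.{v₃} A''] [Abelian A'']
  (r : Recollement A' A A'')

instance : r.iPush.Additive := additive_of_rightAdjoint r.iAdj
instance : r.iShriek.Additive := additive_of_rightAdjoint r.iAdj'
instance : r.jPull.Additive := additive_of_rightAdjoint r.jAdj
instance : r.jPush.Additive := additive_of_rightAdjoint r.jAdj'
instance : r.iPull.Additive := r.iAdj.left_adjoint_additive
instance : r.jShriek.Additive := r.jAdj.left_adjoint_additive

/-- Condition (P): the counit `j_! j^* P ⟶ P` is a monomorphism for every projective `P`. -/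
def ConditionP : Prop :=
  ∀ P : A, Projective P → Mono (r.jAdj.counit.app P)

/-- The class `ℳ^𝒳_𝒴` of all `X` with `i^* X ∈ 𝒳`, `j^* X ∈ 𝒴` and `(L₁ i^*)(X) = 0`. -/
def classM [EnoughProjectives A] (P : ObjectProperty A') (Q : ObjectProperty A'') :
    ObjectProperty A :=
  fun X => P (r.iPull.obj X) ∧ Q (r.jPull.obj X) ∧ IsZero ((r.iPull.leftDerived 1).obj X)

/-- The class `𝒩^𝒳_𝒴` of all `X` with `i^! X ∈ 𝒳`, `j^* X ∈ 𝒴` and `(R₁ i^!)(X) = 0`. -/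
def classN [EnoughInjectives A] (P : ObjectProperty A') (Q : ObjectProperty A'') :
    ObjectProperty A :=
  fun X => P (r.iShriek.obj X) ∧ Q (r.jPull.obj X) ∧ IsZero ((r.iShriek.rightDerived 1).obj X)

end Recollement

end RecollementGluing

/-!
A snake argument on a projective presentation of `X` shows that, under condition (P),
`(L₁ i^*)(X) = 0` if and only if the counit `j_! j^* X ⟶ X` is a monomorphism. Hence every `X ∈ ℳ`
is an extension of `i_* i^* X` by `j_! j^* X`, and adjunction reduces the orthogonality of `ℳ` and
`𝒩` to that of the two given pairs.

Special `ℳ`-approximations of `M` are composites of three epimorphisms with kernel in `𝒩`: the first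
moves `j^*` into `𝒰''` with kernel in `j_* 𝒱''`, the second makes the counit a monomorphism and the
third moves `i^*` into `𝒰'`, both with kernel in `i_* 𝒱'` and without changing `j^*`. The other half
of completeness is Salce's lemma, and the two perpendicularity equalities follow because `ℳ` and `𝒩`
are closed under retracts.
-/

namespace RecollementGluing

section ShortExactSequences

variable {C : Type u} [Category.{v} C] [Abelian C]

theorem shortExact_kernel {X Y : C} (g : X ⟶ Y) [Epi g] :
    (ShortComplex.mk (kernel.ι g) g (kernel.condition g)).ShortExact :=
  .mk' (ShortComplex.exact_kernel g) inferInstance ‹_›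

theorem shortExact_cokernel {X Y : C} (f : X ⟶ Y) [Mono f] :
    (ShortComplex.mk f (cokernel.π f) (cokernel.condition f)).ShortExact :=
  .mk' (ShortComplex.exact_cokernel f) ‹_› inferInstance

theorem shortExact_of_isPullback {S : ShortComplex C} (hS : S.ShortExact) {E D : C}
    {p : E ⟶ S.X₂} {q : E ⟶ D} {h : D ⟶ S.X₃} (sq : IsPullback p q S.g h) {i : S.X₁ ⟶ E}
    (hp : i ≫ p = S.f) (hq : i ≫ q = 0) : (ShortComplex.mk i q hq).ShortExact := by
  have := hS.mono_f
  have hi : Mono i := mono_of_mono_fac hp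
  have he : Epi q := (MorphismProperty.epimorphisms C).of_isPullback sq hS.epi_g
  refine .mk' ?_ hi he
  rw [ShortComplex.exact_iff_exact_up_to_refinements]
  intro T x (hx : x ≫ q = 0)
  obtain ⟨T', π, hπ, y, hy⟩ := hS.exact.exact_up_to_refinements (x ≫ p)
    (by rw [Category.assoc, sq.w, reassoc_of% hx, zero_comp])
  exact ⟨T', π, hπ, y, sq.hom_ext (by simpa [hp] using hy) (by simp [hx, hq])⟩

theorem shortExact_of_isPushout {S : ShortComplex C} (hS : S.ShortExact) {E D : C}
    {h : S.X₁ ⟶ D} {p : S.X₂ ⟶ E} {q : D ⟶ E} (sq : IsPushout S.f h p q) {i : E ⟶ S.X₃}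
    (hp : p ≫ i = S.g) (hq : q ≫ i = 0) : (ShortComplex.mk q i hq).ShortExact :=
  (shortExact_of_isPullback hS.op sq.op.flip (i := i.op) (Quiver.Hom.unop_inj hp)
    (Quiver.Hom.unop_inj hq)).unop

theorem shortExact_comp_of_isPullback {S : ShortComplex C} (hS : S.ShortExact) {X E : C}
    {f : X ⟶ S.X₂} [Epi f] {p : E ⟶ X} {q : E ⟶ S.X₁} (sq : IsPullback p q f S.f) :
    (ShortComplex.mk p (f ≫ S.g) (by simp [sq.w_assoc])).ShortExact := by
  have := hS.epi_g
  have hp : Mono p := (MorphismProperty.monomorphisms C).of_isPullback sq.flip hS.mono_f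
  refine .mk' ?_ hp (epi_comp f S.g)
  rw [ShortComplex.exact_iff_exact_up_to_refinements]
  intro T x (hx : x ≫ f ≫ S.g = 0)
  have hx' : (x ≫ f) ≫ S.g = 0 := by rw [Category.assoc, hx]
  obtain ⟨T', π, hπ, y, hy⟩ := hS.exact.exact_up_to_refinements (x ≫ f) hx'
  exact ⟨T', π, hπ, sq.lift (π ≫ x) y (by rw [Category.assoc, hy]), (sq.lift_fst _ _ _).symm⟩

theorem shortExact_comp_of_isPushout {S : ShortComplex C} (hS : S.ShortExact) {X E : C}
    {f : S.X₂ ⟶ X} [Mono f] {p : X ⟶ E} {q : S.X₃ ⟶ E} (sq : IsPushout f S.g p q) :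
    (ShortComplex.mk (S.f ≫ f) p (by simp [sq.w])).ShortExact :=
  have : Epi (Y := S.op.X₂) f.op := op_epi_of_mono f
  (shortExact_comp_of_isPullback hS.op sq.op.flip).unop

theorem isPushout_of_shortExact {S : ShortComplex C} (hS : S.ShortExact) {K Y : C}
    {f : K ⟶ Y} {g : Y ⟶ S.X₃} {w : f ≫ g = 0} (hT : (ShortComplex.mk f g w).ShortExact)
    {a : S.X₁ ⟶ K} {b : S.X₂ ⟶ Y} (h₁ : S.f ≫ b = a ≫ f) (h₂ : b ≫ g = S.g) :
    IsPushout S.f a b f := by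
  have sq := IsPushout.of_hasPushout S.f a
  let φ : ShortComplex.mk (pushout.inr S.f a) (sq.desc S.g 0 (by simp)) (by simp) ⟶
      ShortComplex.mk f g w :=
    { τ₁ := 𝟙 _
      τ₂ := sq.desc b f h₁
      τ₃ := 𝟙 _
      comm₂₃ := sq.hom_ext (by simp [h₂]) (by simp [w]) }
  have : IsIso φ.τ₂ := ShortComplex.isIso₂_of_shortExact_of_isIso₁₃ φ
    (shortExact_of_isPushout hS sq (by simp) (by simp)) hT
  exact sq.of_iso (Iso.refl _) (Iso.refl _) (Iso.refl _) (asIso φ.τ₂) (by simp) (by simp)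
    (by simp [φ]) (by simp [φ])

theorem shortExact_biprod_of_isPushout {X₁ X₂ X₃ X₄ : C} {k : X₁ ⟶ X₂} {a : X₁ ⟶ X₃}
    {p : X₂ ⟶ X₄} {q : X₃ ⟶ X₄} (sq : IsPushout k a p q) [Mono k] :
    (ShortComplex.mk (biprod.lift k (-a)) (biprod.desc p q) (by simp [sq.w])).ShortExact :=
  .mk' sq.exact_shortComplex (mono_of_mono_fac (biprod.lift_fst k (-a))) sq.epi_shortComplex_g

theorem exact_comp_iff_mono {S : ShortComplex C} (hS : S.Exact) [Epi S.g] {Z : C} (k : S.X₃ ⟶ Z) :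
    (ShortComplex.mk S.f (S.g ≫ k) (by simp)).Exact ↔ Mono k := by
  constructor
  · intro h
    refine Preadditive.mono_of_cancel_zero _ fun {T} x hx => ?_
    obtain ⟨T₁, π₁, _, y, hy⟩ := surjective_up_to_refinements_of_epi S.g x
    obtain ⟨T₂, π₂, _, z, hz⟩ := h.exact_up_to_refinements y
      (by dsimp only; rw [← reassoc_of% hy, hx, comp_zero])
    dsimp only at z hz
    rw [← cancel_epi π₁, ← cancel_epi π₂, hy, reassoc_of% hz, S.zero]
    simp
  · intro _
    let φ : S ⟶ ShortComplex.mk S.f (S.g ≫ k) (by simp) := { τ₁ := 𝟙 _, τ₂ := 𝟙 _, τ₃ := k }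
    exact (ShortComplex.exact_iff_of_epi_of_isIso_of_mono φ).1 hS

/-- If `X₂` and `Y₁` are viewed as subobjects of `Y₂`, both exactness statements say that `X₁` maps
onto `X₂ ∩ Y₁`. -/
theorem exact_comp_of_comm {X₁ X₂ Y₁ Y₂ Y₃ Z : C} {f : X₁ ⟶ X₂} {a : X₁ ⟶ Y₁} {b : X₂ ⟶ Y₂}
    {f' : Y₁ ⟶ Y₂} {g' : Y₂ ⟶ Y₃} {q : Y₂ ⟶ Z} (comm : f ≫ b = a ≫ f') (wg : f' ≫ g' = 0)
    {wq : b ≫ q = 0} (hq : (ShortComplex.mk b q wq).Exact) [Mono f'] {w : f ≫ b ≫ g' = 0}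
    (h : (ShortComplex.mk f (b ≫ g') w).Exact) :
    (ShortComplex.mk a (f' ≫ q) (by rw [← reassoc_of% comm, wq, comp_zero])).Exact := by
  rw [ShortComplex.exact_iff_exact_up_to_refinements]
  intro T x (hx : x ≫ f' ≫ q = 0)
  obtain ⟨T₁, π₁, _, y, hy⟩ := hq.exact_up_to_refinements (x ≫ f') (by simpa using hx)
  dsimp only at y hy
  obtain ⟨T₂, π₂, _, z, hz⟩ := h.exact_up_to_refinements y
    (by dsimp only; rw [← reassoc_of% hy, wg, comp_zero, comp_zero])
  dsimp only at z hz
  refine ⟨T₂, π₂ ≫ π₁, epi_comp _ _, z, ?_⟩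
  dsimp only
  rw [← cancel_mono f', Category.assoc, Category.assoc, Category.assoc, hy, reassoc_of% hz, comm]

end ShortExactSequences

section Ext

variable {C : Type u} [Category.{v} C] [Abelian C]

open Abelian

attribute [local instance] HasExt.standard

theorem ext1Vanishes_iff {X Y : C} :
    Ext1Vanishes X Y ↔ ∀ x : Abelian.Ext.{max u v} X Y 1, x = 0 :=
  ⟨fun h x => h.elim x 0, subsingleton_of_forall_eq 0⟩

theorem ext1Vanishes_of_projective (X Y : C) [Projective X] : Ext1Vanishes X Y :=
  Ext.subsingleton_of_projective X Y 0

theorem ext1Vanishes_of_injective (X Y : C) [Injective Y] : Ext1Vanishes X Y :=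
  Ext.subsingleton_of_injective X Y 0

theorem Ext1Vanishes.of_retract_left {X X' Y : C} (h : Ext1Vanishes X' Y) (r : Retract X X') :
    Ext1Vanishes X Y := by
  rw [ext1Vanishes_iff] at h ⊢
  intro x
  rw [← Ext.mk₀_id_comp x, ← r.retract, ← Ext.mk₀_comp_mk₀_assoc,
    h ((Ext.mk₀ r.r).comp x (zero_add 1)), Ext.comp_zero]

theorem Ext1Vanishes.of_retract_right {X Y Y' : C} (h : Ext1Vanishes X Y') (r : Retract Y Y') :
    Ext1Vanishes X Y := by
  rw [ext1Vanishes_iff] at h ⊢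
  intro x
  rw [← Ext.comp_mk₀_id x, ← r.retract, ← Ext.mk₀_comp_mk₀, ← Ext.comp_assoc_of_third_deg_zero,
    h (x.comp (Ext.mk₀ r.i) (add_zero 1)), Ext.zero_comp]

theorem ext1Vanishes_middle_left {S : ShortComplex C} (hS : S.ShortExact) {Y : C}
    (h₁ : Ext1Vanishes S.X₁ Y) (h₃ : Ext1Vanishes S.X₃ Y) : Ext1Vanishes S.X₂ Y := by
  rw [ext1Vanishes_iff] at h₁ h₃ ⊢
  intro x
  obtain ⟨y, rfl⟩ := Ext.contravariant_sequence_exact₂ hS Y x (h₁ _)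
  rw [h₃ y, Ext.comp_zero]

theorem ext1Vanishes_middle_right {S : ShortComplex C} (hS : S.ShortExact) {X : C}
    (h₁ : Ext1Vanishes X S.X₁) (h₃ : Ext1Vanishes X S.X₃) : Ext1Vanishes X S.X₂ := by
  rw [ext1Vanishes_iff] at h₁ h₃ ⊢
  intro x
  obtain ⟨y, rfl⟩ := Ext.covariant_sequence_exact₂ X hS x (h₃ _)
  rw [h₁ y, Ext.zero_comp]

theorem Ext1Vanishes.exists_lift {X : C} {S : ShortComplex C} (h : Ext1Vanishes X S.X₁)
    (hS : S.ShortExact) (x : X ⟶ S.X₃) : ∃ y : X ⟶ S.X₂, y ≫ S.g = x := by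
  obtain ⟨y, hy⟩ := Ext.covariant_sequence_exact₃ X hS (Ext.mk₀ x) (zero_add 1)
    (ext1Vanishes_iff.1 h _)
  obtain ⟨y, rfl⟩ := Ext.homEquiv₀.symm.surjective y
  exact ⟨y, (Ext.mk₀_bijective _ _).1 (by simpa using hy)⟩

theorem Ext1Vanishes.exists_extension {Y : C} {S : ShortComplex C} (h : Ext1Vanishes S.X₃ Y)
    (hS : S.ShortExact) (x : S.X₁ ⟶ Y) : ∃ y : S.X₂ ⟶ Y, S.f ≫ y = x := by
  obtain ⟨y, hy⟩ := Ext.contravariant_sequence_exact₁ hS Y (Ext.mk₀ x) (add_zero 1)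
    (ext1Vanishes_iff.1 h _)
  obtain ⟨y, rfl⟩ := Ext.homEquiv₀.symm.surjective y
  exact ⟨y, (Ext.mk₀_bijective _ _).1 (by simpa using hy)⟩

theorem ext1Vanishes_of_exists_extension {S : ShortComplex C} (hS : S.ShortExact)
    [Projective S.X₂] {Y : C} (h : ∀ x : S.X₁ ⟶ Y, ∃ y : S.X₂ ⟶ Y, S.f ≫ y = x) :
    Ext1Vanishes S.X₃ Y := by
  rw [ext1Vanishes_iff]
  intro x
  obtain ⟨y, rfl⟩ := Ext.contravariant_sequence_exact₃ hS Y x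
    (ext1Vanishes_iff.1 (ext1Vanishes_of_projective S.X₂ Y) _) (add_zero 1)
  obtain ⟨y, rfl⟩ := Ext.homEquiv₀.symm.surjective y
  obtain ⟨z, rfl⟩ := h y
  rw [Ext.homEquiv₀_symm_apply, ← Ext.mk₀_comp_mk₀]
  exact hS.extClass_comp_assoc _

theorem ext1Vanishes_of_exists_retraction [EnoughProjectives C] {X Y : C}
    (h : ∀ (E : C) (f : Y ⟶ E) (g : E ⟶ X) (w : f ≫ g = 0),
      (ShortComplex.mk f g w).ShortExact → ∃ s : E ⟶ Y, f ≫ s = 𝟙 Y) :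
    Ext1Vanishes X Y := by
  have hS := shortExact_kernel (Projective.π X)
  refine ext1Vanishes_of_exists_extension hS fun x => ?_
  have sq := IsPushout.of_hasPushout (kernel.ι (Projective.π X)) x
  obtain ⟨s, hs⟩ := h _ _ _ _ (shortExact_of_isPushout hS sq (sq.inl_desc _ 0 (by simp))
    (sq.inr_desc _ _ _))
  refine ⟨pushout.inl _ _ ≫ s, ?_⟩
  dsimp only
  rw [sq.w_assoc, hs, Category.comp_id]

theorem ext1Vanishes_of_exists_section [EnoughProjectives C] {X Y : C}
    (h : ∀ (E : C) (f : Y ⟶ E) (g : E ⟶ X) (w : f ≫ g = 0),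
      (ShortComplex.mk f g w).ShortExact → ∃ s : X ⟶ E, s ≫ g = 𝟙 X) :
    Ext1Vanishes X Y := by
  refine ext1Vanishes_of_exists_retraction fun E f g w hS => ?_
  obtain ⟨s, hs⟩ := h E f g w hS
  let σ := ShortComplex.Splitting.ofExactOfSection _ hS.exact s hs hS.mono_f
  exact ⟨σ.r, σ.f_r⟩

end Ext

section DerivedFunctors

variable {C : Type u₁} [Category.{v₁} C] [Abelian C] {D : Type u₂} [Category.{v₂} D] [Abelian D]

section RightExact

variable (F : C ⥤ D) [PreservesFiniteColimits F]

theorem isIso_map_g_of_isZero [F.Additive] {S : ShortComplex C} (hS : S.Exact) [Epi S.g]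
    (h : IsZero (F.obj S.X₁)) : IsIso (F.map S.g) := by
  have hFS := hS.map_of_epi_of_preservesCokernel F ‹_› inferInstance
  have : Mono (F.map S.g) := hFS.mono_g (h.eq_of_src _ _)
  exact isIso_of_mono_of_epi _

theorem mono_map_of_mono_map_of_projective {S : ShortComplex C} (hS : S.ShortExact)
    [Projective S.X₂] (hF : Mono (F.map S.f)) {K Y : C} {f : K ⟶ Y} {g : Y ⟶ S.X₃}
    {w : f ≫ g = 0} (hT : (ShortComplex.mk f g w).ShortExact) : Mono (F.map f) := by
  have : Epi g := hT.epi_g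
  have : Mono f := hT.mono_f
  have h : (S.f ≫ Projective.factorThru S.g g) ≫ g = 0 := by simp
  have sq := isPushout_of_shortExact hS hT (a := hT.exact.lift _ h)
    (b := Projective.factorThru S.g g) (hT.exact.lift_f _ h).symm (by simp)
  exact (MorphismProperty.monomorphisms D).of_isPushout (sq.map F).flip hF

variable [F.Additive]

theorem exact_map_iff_mono_map {S : ShortComplex C} (hS : S.Exact) {I : C} {π : S.X₂ ⟶ I}
    {k : I ⟶ S.X₃} [Epi π] [Mono k] (h : π ≫ k = S.g) :
    (S.map F).Exact ↔ Mono (F.map k) := by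
  have w : S.f ≫ π = 0 := by simp [← cancel_mono k, h]
  let φ : ShortComplex.mk S.f π w ⟶ S := { τ₁ := 𝟙 _, τ₂ := 𝟙 _, τ₃ := k }
  have hπ : (ShortComplex.mk S.f π w).Exact :=
    (ShortComplex.exact_iff_of_epi_of_isIso_of_mono φ).2 hS
  have hFπ := hπ.map_of_epi_of_preservesCokernel F ‹_› inferInstance
  have : Epi ((ShortComplex.mk S.f π w).map F).g := inferInstanceAs (Epi (F.map π))
  have hF : F.map π ≫ F.map k = F.map S.g := by rw [← F.map_comp, h]
  refine Iff.trans ?_ (exact_comp_iff_mono hFπ (F.map k))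
  exact ShortComplex.exact_iff_of_iso <|
    ShortComplex.isoMk (Iso.refl _) (Iso.refl _) (Iso.refl _)
      ((Category.id_comp _).trans (Category.comp_id _).symm)
      ((Category.id_comp _).trans (hF.trans (Category.comp_id _).symm))

variable [EnoughProjectives C]

theorem isZero_leftDerived_one_iff_mono_map {S : ShortComplex C} (hS : S.ShortExact)
    [Projective S.X₂] : IsZero ((F.leftDerived 1).obj S.X₃) ↔ Mono (F.map S.f) := by
  let P := projectiveResolution S.X₃
  let p : P.complex.X 0 ⟶ S.X₃ := P.π.f 0
  have : Epi p := inferInstanceAs (Epi (P.π.f 0))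
  have hp : (ShortComplex.mk _ p P.complex_d_comp_π_f_zero).Exact := P.exact₀
  have : Epi (kernel.lift p (P.complex.d 1 0) P.complex_d_comp_π_f_zero) :=
    (ShortComplex.exact_iff_epi_kernel_lift _).1 hp
  have hT := shortExact_kernel p
  calc IsZero ((F.leftDerived 1).obj S.X₃)
    _ ↔ ((ShortComplex.mk _ _ (P.complex.d_comp_d 2 1 0)).map F).Exact := by
      rw [(P.isoLeftDerivedObj F 1).isZero_iff]
      refine (HomologicalComplex.exactAt_iff_isZero_homology _ _).symm.trans ?_
      rw [HomologicalComplex.exactAt_iff' _ 2 1 0 (by simp) (by simp)]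
      rfl
    _ ↔ Mono (F.map (kernel.ι p)) :=
      exact_map_iff_mono_map F (P.exact_succ 0) (kernel.lift_ι _ _ _)
    _ ↔ Mono (F.map S.f) :=
      ⟨fun h => mono_map_of_mono_map_of_projective F hT h hS,
        fun h => mono_map_of_mono_map_of_projective F hS h hT⟩

theorem shortExact_map_of_isZero_leftDerived_one {S : ShortComplex C} (hS : S.ShortExact)
    (h : IsZero ((F.leftDerived 1).obj S.X₃)) : (S.map F).ShortExact := by
  have hT := shortExact_kernel (Projective.π S.X₃)
  have := hS.epi_g
  exact .mk' (hS.exact.map_of_epi_of_preservesCokernel F this inferInstance)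
    (mono_map_of_mono_map_of_projective F hT ((isZero_leftDerived_one_iff_mono_map F hT).1 h) hS)
    (inferInstanceAs (Epi (F.map S.g)))

end RightExact

section LeftExact

variable (G : C ⥤ D) [PreservesFiniteLimits G]

attribute [local instance] preservesFiniteColimits_op

theorem epi_map_of_epi_map_of_injective {S : ShortComplex C} (hS : S.ShortExact)
    [Injective S.X₂] (hG : Epi (G.map S.g)) {Y K : C} {f : S.X₁ ⟶ Y} {g : Y ⟶ K}
    {w : f ≫ g = 0} (hT : (ShortComplex.mk f g w).ShortExact) : Epi (G.map g) := by
  have : Projective S.op.X₂ := inferInstanceAs (Projective (Opposite.op S.X₂))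
  have : Mono (G.map g).op :=
    mono_map_of_mono_map_of_projective G.op hS.op (op_mono_of_epi (G.map S.g)) hT.op
  exact unop_epi_of_mono (G.map g).op

variable [G.Additive]

theorem exact_map_iff_epi_map {S : ShortComplex C} (hS : S.Exact) {I : C} {π : I ⟶ S.X₂}
    {k : S.X₁ ⟶ I} [Epi k] [Mono π] (h : k ≫ π = S.f) :
    (S.map G).Exact ↔ Epi (G.map k) := by
  have : Epi (X := S.op.X₂) π.op := op_epi_of_mono π
  have : Mono (Y := S.op.X₃) k.op := op_mono_of_epi k
  rw [← ShortComplex.exact_op_iff, ← op_mono_iff]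
  exact exact_map_iff_mono_map G.op hS.op (π := π.op) (k := k.op) (Quiver.Hom.unop_inj h)

variable [EnoughInjectives C]

theorem isZero_rightDerived_one_iff_epi_map {S : ShortComplex C} (hS : S.ShortExact)
    [Injective S.X₂] : IsZero ((G.rightDerived 1).obj S.X₁) ↔ Epi (G.map S.g) := by
  let I := injectiveResolution S.X₁
  let i : S.X₁ ⟶ I.cocomplex.X 0 := I.ι.f 0
  have : Mono i := inferInstanceAs (Mono (I.ι.f 0))
  have hi : (ShortComplex.mk i _ I.ι_f_zero_comp_complex_d).Exact := I.exact₀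
  have : Mono (cokernel.desc i (I.cocomplex.d 0 1) I.ι_f_zero_comp_complex_d) :=
    (ShortComplex.exact_iff_mono_cokernel_desc _).1 hi
  have hT := shortExact_cokernel i
  calc IsZero ((G.rightDerived 1).obj S.X₁)
    _ ↔ ((ShortComplex.mk _ _ (I.cocomplex.d_comp_d 0 1 2)).map G).Exact := by
      rw [(I.isoRightDerivedObj G 1).isZero_iff]
      refine (HomologicalComplex.exactAt_iff_isZero_homology _ _).symm.trans ?_
      rw [HomologicalComplex.exactAt_iff' _ 0 1 2 (by simp) (by simp)]
      rfl
    _ ↔ Epi (G.map (cokernel.π i)) :=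
      exact_map_iff_epi_map G (I.exact_succ 0) (cokernel.π_desc _ _ _)
    _ ↔ Epi (G.map S.g) :=
      ⟨fun h => epi_map_of_epi_map_of_injective G hT h hS,
        fun h => epi_map_of_epi_map_of_injective G hS h hT⟩

theorem shortExact_map_of_isZero_rightDerived_one {S : ShortComplex C} (hS : S.ShortExact)
    (h : IsZero ((G.rightDerived 1).obj S.X₁)) : (S.map G).ShortExact := by
  have hT := shortExact_cokernel (Injective.ι S.X₁)
  have := hS.mono_f
  exact .mk' (hS.exact.map_of_mono_of_preservesKernel G this inferInstance)
    (inferInstanceAs (Mono (G.map S.f)))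
    (epi_map_of_epi_map_of_injective G hT ((isZero_rightDerived_one_iff_epi_map G hT).1 h) hS)

theorem isZero_rightDerived_one_of_shortExact {S : ShortComplex C} (hS : S.ShortExact)
    (h₁ : IsZero ((G.rightDerived 1).obj S.X₁)) (h₃ : IsZero ((G.rightDerived 1).obj S.X₃)) :
    IsZero ((G.rightDerived 1).obj S.X₂) := by
  let ι := Injective.ι S.X₂
  have sq := IsPushout.of_hasPushout ι S.g
  have h : pushout.inl ι S.g ≫ sq.desc (cokernel.π ι) 0 (by simp) = cokernel.π ι :=
    sq.inl_desc _ _ _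
  have h_inl : Epi (G.map (pushout.inl ι S.g)) :=
    (shortExact_map_of_isZero_rightDerived_one G (shortExact_comp_of_isPushout hS sq) h₁).epi_g
  have h_desc : Epi (G.map (sq.desc (cokernel.π ι) 0 (by simp))) :=
    (shortExact_map_of_isZero_rightDerived_one G
      (shortExact_of_isPushout (shortExact_cokernel ι) sq h (sq.inr_desc _ _ _)) h₃).epi_g
  refine (isZero_rightDerived_one_iff_epi_map G (shortExact_cokernel ι)).2 ?_
  dsimp only
  rw [← h, G.map_comp]
  exact epi_comp _ _

end LeftExact

end DerivedFunctors

section CotorsionPairs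

variable {C : Type u} [Category.{v} C] [Abelian C] {U V : ObjectProperty C}

theorem IsCotorsionPair.ext1Vanishes (h : IsCotorsionPair U V) {X Y : C} (hX : U X) (hY : V Y) :
    Ext1Vanishes X Y := by
  rw [← h.rightPerp_eq] at hY
  exact hY X hX

theorem IsCotorsionPair.isStableUnderRetracts_left (h : IsCotorsionPair U V) :
    U.IsStableUnderRetracts where
  of_retract r hX := by
    rw [← h.leftPerp_eq]
    exact fun Y hY => (h.ext1Vanishes hX hY).of_retract_left r

theorem IsCotorsionPair.isStableUnderRetracts_right (h : IsCotorsionPair U V) :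
    V.IsStableUnderRetracts where
  of_retract r hY := by
    rw [← h.rightPerp_eq]
    exact fun X hX => (h.ext1Vanishes hX hY).of_retract_right r

theorem IsCotorsionPair.isClosedUnderExtensions_right (h : IsCotorsionPair U V) :
    V.IsClosedUnderExtensions where
  prop_X₂_of_shortExact hS h₁ h₃ := by
    rw [← h.rightPerp_eq]
    exact fun X hX => ext1Vanishes_middle_right hS (h.ext1Vanishes hX h₁) (h.ext1Vanishes hX h₃)

theorem IsCotorsionPair.left_of_projective (h : IsCotorsionPair U V) (P : C) [Projective P] :
    U P := by
  rw [← h.leftPerp_eq]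
  exact fun Y _ => ext1Vanishes_of_projective P Y

theorem IsCotorsionPair.right_of_injective (h : IsCotorsionPair U V) (I : C) [Injective I] :
    V I := by
  rw [← h.rightPerp_eq]
  exact fun X _ => ext1Vanishes_of_injective X I

theorem IsCotorsionPair.right_of_isZero (h : IsCotorsionPair U V) {Y : C} (hY : IsZero Y) : V Y :=
  have := hY.injective
  h.right_of_injective Y

/-- The class of epimorphisms with kernel in `𝒱`: an epimorphism `X ⟶ M` in this class with
`X ∈ 𝒰` is a special `𝒰`-approximation of `M`. The kernel is any object of `𝒱` completing the
morphism to a short exact sequence, so that `𝒱` need not be closed under isomorphisms. -/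
def epiWithKernel (V : ObjectProperty C) : MorphismProperty C :=
  fun X _ q => ∃ (K : C) (i : K ⟶ X) (w : i ≫ q = 0), (ShortComplex.mk i q w).ShortExact ∧ V K

theorem epiWithKernel_comp [V.IsClosedUnderExtensions] {X Y Z : C} {p : X ⟶ Y} {q : Y ⟶ Z}
    (hp : epiWithKernel V p) (hq : epiWithKernel V q) : epiWithKernel V (p ≫ q) := by
  obtain ⟨K, i, wi, hS, hK⟩ := hp
  obtain ⟨L, j, wj, hT, hL⟩ := hq
  have : Epi p := hS.epi_g
  have sq := IsPullback.of_hasPullback p j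
  have hE := shortExact_of_isPullback hS sq (sq.lift_fst i 0 (by simp [wi])) (sq.lift_snd _ _ _)
  exact ⟨_, _, _, shortExact_comp_of_isPullback hT sq, V.prop_X₂_of_shortExact hE hK hL⟩

/-- Salce's lemma: embed `M` into an injective object and pull back an approximation of the
cokernel. -/
theorem exists_right_of_exists_epiWithKernel [EnoughInjectives C] [V.IsClosedUnderExtensions]
    (hV : ∀ (I : C) [Injective I], V I)
    (h : ∀ M : C, ∃ (X : C) (q : X ⟶ M), epiWithKernel V q ∧ U X) (M : C) :
    ∃ (Y X : C) (f : M ⟶ Y) (g : Y ⟶ X) (w : f ≫ g = 0),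
      (ShortComplex.mk f g w).ShortExact ∧ U X ∧ V Y := by
  have hI := shortExact_cokernel (Injective.ι M)
  obtain ⟨X, q, ⟨K, i, w, hS, hK⟩, hX⟩ := h (cokernel (Injective.ι M))
  have sq := IsPullback.of_hasPullback (cokernel.π (Injective.ι M)) q
  have hM := shortExact_of_isPullback hI sq (sq.lift_fst (Injective.ι M) 0 (by simp))
    (sq.lift_snd _ _ _)
  have hY := shortExact_of_isPullback hS sq.flip (sq.lift_snd 0 i (by simp [w]))
    (sq.lift_fst _ _ _)
  exact ⟨_, X, _, _, _, hM, hX, V.prop_X₂_of_shortExact hY hK (hV _)⟩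

theorem IsCotorsionPair.cokernel_mem_of_kernel_mem [EnoughProjectives C] (h : IsCotorsionPair U V)
    (hU : ∀ S : ShortComplex C, S.ShortExact → U S.X₂ → U S.X₃ → U S.X₁) {S : ShortComplex C}
    (hS : S.ShortExact) (h₁ : V S.X₁) (h₂ : V S.X₂) : V S.X₃ := by
  rw [← h.rightPerp_eq]
  intro X hX
  have hT := shortExact_kernel (Projective.π X)
  have hK : U (kernel (Projective.π X)) := hU _ hT (h.left_of_projective _) hX
  refine ext1Vanishes_of_exists_extension hT fun x => ?_
  obtain ⟨y, rfl⟩ := (h.ext1Vanishes hK h₁).exists_lift hS x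
  obtain ⟨z, rfl⟩ := (h.ext1Vanishes hX h₂).exists_extension hT y
  exact ⟨z ≫ S.g, by simp⟩

theorem isCompleteHereditaryCotorsionPair_of_exists_epiWithKernel [EnoughProjectives C]
    [EnoughInjectives C] [U.IsStableUnderRetracts] [V.IsStableUnderRetracts]
    [V.IsClosedUnderExtensions] (hV : ∀ (I : C) [Injective I], V I)
    (hU : ∀ S : ShortComplex C, S.ShortExact → U S.X₂ → U S.X₃ → U S.X₁)
    (hUV : ∀ X Y : C, U X → V Y → Ext1Vanishes X Y)
    (h : ∀ M : C, ∃ (X : C) (q : X ⟶ M), epiWithKernel V q ∧ U X) :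
    IsCompleteHereditaryCotorsionPair U V := by
  have hright := exists_right_of_exists_epiWithKernel hV h
  have hr : rightPerp U = V := by
    ext Y
    refine ⟨fun hY => ?_, fun hY X hX => hUV X Y hX hY⟩
    obtain ⟨Y', X, f, g, w, hS, hX, hY'⟩ := hright Y
    obtain ⟨t, ht⟩ := (hY X hX).exists_extension hS (𝟙 Y)
    exact V.prop_of_retract ⟨f, t, ht⟩ hY'
  have hl : leftPerp V = U := by
    ext X
    refine ⟨fun hX => ?_, fun hX Y hY => hUV X Y hX hY⟩
    obtain ⟨X', q, ⟨K, i, w, hS, hK⟩, hX'⟩ := h X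
    obtain ⟨t, ht⟩ := (hX K hK).exists_lift hS (𝟙 X)
    exact U.prop_of_retract ⟨t, q, ht⟩ hX'
  have hC : IsCotorsionPair U V := ⟨hr, hl⟩
  refine { hC with
    exists_left := fun M => ?_
    exists_right := hright
    kernel_mem := hU
    cokernel_mem := fun S => hC.cokernel_mem_of_kernel_mem hU }
  obtain ⟨X, q, ⟨K, i, w, hS, hK⟩, hX⟩ := h M
  exact ⟨K, X, i, q, w, hS, hX, hK⟩

theorem IsCompleteHereditaryCotorsionPair.exists_epiWithKernel
    (h : IsCompleteHereditaryCotorsionPair U V) (M : C) :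
    ∃ (X : C) (q : X ⟶ M), epiWithKernel V q ∧ U X := by
  obtain ⟨K, X, i, q, w, hS, hX, hK⟩ := h.exists_left M
  exact ⟨X, q, ⟨K, i, w, hS, hK⟩, hX⟩

end CotorsionPairs

theorem exists_section_of_adjunction {C : Type u₁} [Category.{v₁} C] {D : Type u₂}
    [Category.{v₂} D] {L : C ⥤ D} {R : D ⥤ C} (adj : L ⊣ R) {U : C} {E : D}
    (g : E ⟶ L.obj U) (t : U ⟶ R.obj E) (ht : t ≫ R.map g = adj.unit.app U) :
    ∃ s : L.obj U ⟶ E, s ≫ g = 𝟙 _ := by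
  refine ⟨(adj.homEquiv _ _).symm t, ?_⟩
  rw [← adj.homEquiv_naturality_right_symm, Equiv.symm_apply_eq, ht, adj.homEquiv_id]

namespace Recollement

variable {A' : Type u₁} [Category.{v₁} A'] [Abelian A']
  {A : Type u₂} [Category.{v₂} A] [Abelian A]
  {A'' : Type u₃} [Category.{v₃} A''] [Abelian A'']
  (r : Recollement A' A A'')

instance : r.iPush.Full := r.iPush_full
instance : r.iPush.Faithful := r.iPush_faithful
instance : r.jShriek.Full := r.jShriek_full
instance : r.jShriek.Faithful := r.jShriek_faithful
instance : r.jPush.Full := r.jPush_full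
instance : r.jPush.Faithful := r.jPush_faithful

instance : r.iPull.IsLeftAdjoint := r.iAdj.isLeftAdjoint
instance : r.iPush.IsRightAdjoint := r.iAdj.isRightAdjoint
instance : r.iPush.IsLeftAdjoint := r.iAdj'.isLeftAdjoint
instance : r.iShriek.IsRightAdjoint := r.iAdj'.isRightAdjoint
instance : r.jShriek.IsLeftAdjoint := r.jAdj.isLeftAdjoint
instance : r.jPull.IsRightAdjoint := r.jAdj.isRightAdjoint
instance : r.jPull.IsLeftAdjoint := r.jAdj'.isLeftAdjoint
instance : r.jPush.IsRightAdjoint := r.jAdj'.isRightAdjoint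

section Gluing

theorem isZero_jPull_iff (X : A) : IsZero (r.jPull.obj X) ↔ r.iPush.essImage X := by
  rw [← r.kernel_eq]
  rfl

theorem isZero_jPull_iPush (Y : A') : IsZero (r.jPull.obj (r.iPush.obj Y)) :=
  (r.isZero_jPull_iff _).2 (r.iPush.obj_mem_essImage Y)

theorem jShriek_iPush_hom_eq_zero {Z : A''} {Y : A'} (f : r.jShriek.obj Z ⟶ r.iPush.obj Y) :
    f = 0 :=
  (r.jAdj.homEquiv _ _).injective ((r.isZero_jPull_iPush _).eq_of_tgt _ _)

theorem iPush_jPush_hom_eq_zero {Y : A'} {Z : A''} (f : r.iPush.obj Y ⟶ r.jPush.obj Z) :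
    f = 0 :=
  (r.jAdj'.homEquiv _ _).symm.injective ((r.isZero_jPull_iPush _).eq_of_src _ _)

theorem isZero_iPull_jShriek (Z : A'') : IsZero (r.iPull.obj (r.jShriek.obj Z)) := by
  rw [IsZero.iff_id_eq_zero]
  apply (r.iAdj.homEquiv _ _).injective
  exact (r.jShriek_iPush_hom_eq_zero _).trans (r.jShriek_iPush_hom_eq_zero _).symm

theorem isZero_iShriek_jPush (Z : A'') : IsZero (r.iShriek.obj (r.jPush.obj Z)) := by
  rw [IsZero.iff_id_eq_zero]
  apply (r.iAdj'.homEquiv _ _).symm.injective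
  exact (r.iPush_jPush_hom_eq_zero _).trans (r.iPush_jPush_hom_eq_zero _).symm

/-- The counit `j_! j^* X ⟶ X`, with its source and target in unfolded form. -/
def jCounit (X : A) : r.jShriek.obj (r.jPull.obj X) ⟶ X := r.jAdj.counit.app X

/-- The unit `X ⟶ i_* i^* X`, with its source and target in unfolded form. -/
def iUnit (X : A) : X ⟶ r.iPush.obj (r.iPull.obj X) := r.iAdj.unit.app X

theorem jCounit_naturality {X Y : A} (f : X ⟶ Y) :
    r.jShriek.map (r.jPull.map f) ≫ r.jCounit Y = r.jCounit X ≫ f :=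
  r.jAdj.counit_naturality f

theorem iUnit_naturality {X Y : A} (f : X ⟶ Y) :
    r.iUnit X ≫ r.iPush.map (r.iPull.map f) = f ≫ r.iUnit Y :=
  r.iAdj.unit_naturality f

instance (X : A) : IsIso (r.jPull.map (r.jCounit X)) :=
  inferInstanceAs (IsIso (r.jPull.map (r.jAdj.counit.app X)))

theorem jCounit_comp_iUnit (X : A) : r.jCounit X ≫ r.iUnit X = 0 :=
  r.jShriek_iPush_hom_eq_zero _

theorem isIso_iUnit_of_isZero {X : A} (hX : IsZero (r.jPull.obj X)) : IsIso (r.iUnit X) := by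
  rw [r.isZero_jPull_iff] at hX
  exact r.iAdj.isIso_unit_app_iff_mem_essImage.2 hX

theorem isZero_jPull_cokernel_jCounit (X : A) :
    IsZero (r.jPull.obj (cokernel (r.jCounit X))) :=
  (isZero_cokernel_of_epi (r.jPull.map (r.jCounit X))).of_iso (PreservesCokernel.iso r.jPull _)

theorem exists_iso_cokernel_jCounit (X : A) :
    ∃ e : r.iPush.obj (r.iPull.obj X) ≅ cokernel (r.jCounit X),
      r.iUnit X ≫ e.hom = cokernel.π (r.jCounit X) := by
  let π := cokernel.π (r.jCounit X)
  have : IsIso (r.iUnit (cokernel (r.jCounit X))) :=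
    r.isIso_iUnit_of_isZero (r.isZero_jPull_cokernel_jCounit X)
  have : IsIso (r.iPull.map π) :=
    isIso_map_g_of_isZero r.iPull (ShortComplex.exact_cokernel (r.jCounit X))
      (r.isZero_iPull_jShriek _)
  refine ⟨asIso (r.iPush.map (r.iPull.map π)) ≪≫ (asIso (r.iUnit _)).symm, ?_⟩
  simp [reassoc_of% r.iUnit_naturality π, π]

theorem exact_jCounit_iUnit (X : A) :
    (ShortComplex.mk _ _ (r.jCounit_comp_iUnit X)).Exact := by
  obtain ⟨e, he⟩ := r.exists_iso_cokernel_jCounit X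
  refine ShortComplex.exact_of_iso ?_ (ShortComplex.exact_cokernel (r.jCounit X))
  exact ShortComplex.isoMk (Iso.refl _) (Iso.refl _) e.symm (by simp) (by simp [← he])

instance epi_iUnit (X : A) : Epi (r.iUnit X) := by
  obtain ⟨e, he⟩ := r.exists_iso_cokernel_jCounit X
  rw [← Iso.eq_comp_inv] at he
  rw [he]
  infer_instance

theorem shortExact_jCounit_iUnit {X : A} (hX : Mono (r.jCounit X)) :
    (ShortComplex.mk _ _ (r.jCounit_comp_iUnit X)).ShortExact :=
  .mk' (r.exact_jCounit_iUnit X) hX (r.epi_iUnit X)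

theorem isZero_iPull_kernel_iUnit (X : A) : IsZero (r.iPull.obj (kernel (r.iUnit X))) := by
  have : Epi (kernel.lift (r.iUnit X) (r.jCounit X) (r.jCounit_comp_iUnit X)) :=
    (ShortComplex.exact_iff_epi_kernel_lift _).1 (r.exact_jCounit_iUnit X)
  exact IsZero.of_epi (r.iPull.map (kernel.lift (r.iUnit X) (r.jCounit X) _))
    (r.isZero_iPull_jShriek _)

/-- A snake argument: with `K ⟶ P ⟶ X` the given sequence, both conditions say that `j_! j^* K`
maps onto the intersection of the subobjects `j_! j^* P` and `K` of `P`. -/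
theorem mono_jCounit_iff {S : ShortComplex A} (hS : S.ShortExact) (h₂ : Mono (r.jCounit S.X₂)) :
    Mono (r.jCounit S.X₃) ↔ Mono (r.iPull.map S.f) := by
  have := hS.epi_g
  have := hS.mono_f
  have hj : (ShortComplex.mk (r.jShriek.map (r.jPull.map S.f)) (r.jShriek.map (r.jPull.map S.g))
      (by simp [← Functor.map_comp])).Exact :=
    hS.exact.map_of_epi_of_preservesCokernel (r.jPull ⋙ r.jShriek) ‹_› inferInstance
  have comm := r.jCounit_naturality S.f
  have wX : r.jShriek.map (r.jPull.map S.f) ≫ r.jCounit S.X₂ ≫ S.g = 0 := by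
    rw [reassoc_of% comm, S.zero, comp_zero]
  have wK : r.jCounit S.X₁ ≫ S.f ≫ r.iUnit S.X₂ = 0 := by
    rw [← reassoc_of% comm, r.jCounit_comp_iUnit, comp_zero]
  calc Mono (r.jCounit S.X₃)
    _ ↔ (ShortComplex.mk _ _ wX).Exact := by
      simpa only [r.jCounit_naturality] using (exact_comp_iff_mono hj (r.jCounit S.X₃)).symm
    _ ↔ (ShortComplex.mk _ _ wK).Exact :=
      ⟨exact_comp_of_comm comm S.zero (r.exact_jCounit_iUnit S.X₂),
        exact_comp_of_comm comm.symm (r.jCounit_comp_iUnit S.X₂) hS.exact⟩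
    _ ↔ Mono (r.iPush.map (r.iPull.map S.f)) := by
      simpa only [r.iUnit_naturality] using
        exact_comp_iff_mono (r.exact_jCounit_iUnit S.X₁) (r.iPush.map (r.iPull.map S.f))
    _ ↔ Mono (r.iPull.map S.f) := ⟨r.iPush.mono_of_mono_map, fun _ => inferInstance⟩

theorem isZero_leftDerived_iPull_iff [EnoughProjectives A] (hP : r.ConditionP) (X : A) :
    IsZero ((r.iPull.leftDerived 1).obj X) ↔ Mono (r.jCounit X) := by
  have hS := shortExact_kernel (Projective.π X)
  exact (isZero_leftDerived_one_iff_mono_map r.iPull hS).trans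
    (r.mono_jCounit_iff hS (hP _ inferInstance)).symm

theorem mono_jCounit_of_mono {X Y : A} (f : X ⟶ Y) [Mono f] [IsIso (r.jPull.map f)]
    (hX : Mono (r.jCounit X)) : Mono (r.jCounit Y) := by
  have h : r.jCounit Y = inv (r.jShriek.map (r.jPull.map f)) ≫ r.jCounit X ≫ f := by
    rw [IsIso.eq_inv_comp, r.jCounit_naturality]
  rw [h]
  infer_instance

theorem mono_jCounit_of_mono_map {X Y : A} (f : X ⟶ Y)
    [Mono (r.jShriek.map (r.jPull.map f))] [Mono (r.jCounit Y)] : Mono (r.jCounit X) :=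
  mono_of_mono_fac (r.jCounit_naturality f).symm

theorem mono_jCounit_biprod {X : A} (hX : Mono (r.jCounit X)) (Y : A') :
    Mono (r.jCounit (X ⊞ r.iPush.obj Y)) := by
  have hS := (ShortComplex.Splitting.ofHasBinaryBiproduct X (r.iPush.obj Y)).shortExact
  have : IsIso (r.jPull.map (biprod.inl : X ⟶ X ⊞ r.iPush.obj Y)) :=
    (hS.map_of_exact r.jPull).isIso_f_iff.2 (r.isZero_jPull_iPush Y)
  exact r.mono_jCounit_of_mono biprod.inl hX

theorem mono_iPull_map_iPush_map {X Y : A'} (f : X ⟶ Y) [Mono f] :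
    Mono (r.iPull.map (r.iPush.map f)) := by
  have : Mono (r.iAdj.counit.app X ≫ f) := mono_comp _ _
  exact mono_of_mono_fac (r.iAdj.counit_naturality f)

end Gluing

section Ext

theorem ext1Vanishes_jShriek [EnoughProjectives A] {Z : A''} {Y : A}
    (h : Ext1Vanishes Z (r.jPull.obj Y)) : Ext1Vanishes (r.jShriek.obj Z) Y := by
  refine ext1Vanishes_of_exists_section fun E f g w hS => ?_
  obtain ⟨t, ht⟩ := h.exists_lift (hS.map_of_exact r.jPull) (r.jAdj.unit.app Z)
  exact exists_section_of_adjunction r.jAdj g t ht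

theorem ext1Vanishes_iPush [EnoughProjectives A] [EnoughInjectives A] {Z : A'} {Y : A}
    (hY : IsZero ((r.iShriek.rightDerived 1).obj Y))
    (h : Ext1Vanishes Z (r.iShriek.obj Y)) : Ext1Vanishes (r.iPush.obj Z) Y := by
  refine ext1Vanishes_of_exists_section fun E f g w hS => ?_
  obtain ⟨t, ht⟩ := h.exists_lift
    (shortExact_map_of_isZero_rightDerived_one r.iShriek hS hY) (r.iAdj'.unit.app Z)
  exact exists_section_of_adjunction r.iAdj' g t ht

theorem ext1Vanishes_jPull_of_injective [EnoughProjectives A''] {Z : A''} (I : A) [Injective I]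
    (hZ : IsZero ((r.jShriek.leftDerived 1).obj Z)) : Ext1Vanishes Z (r.jPull.obj I) := by
  refine ext1Vanishes_of_exists_retraction fun E f g w hS => ?_
  have : Mono (r.jShriek.map f) :=
    (shortExact_map_of_isZero_leftDerived_one r.jShriek hS hZ).mono_f
  refine ⟨r.jAdj.homEquiv _ _ (Injective.factorThru (r.jCounit I) (r.jShriek.map f)), ?_⟩
  rw [← r.jAdj.homEquiv_naturality_left, Injective.comp_factorThru, ← Equiv.eq_symm_apply,
    r.jAdj.homEquiv_symm_id]
  rfl

theorem epi_iShriek_map {X Y : A} (hX : IsZero (r.jPull.obj X)) (hY : IsZero (r.jPull.obj Y))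
    (f : X ⟶ Y) [Epi f] : Epi (r.iShriek.map f) := by
  rw [r.isZero_jPull_iff, ← r.iAdj'.isIso_counit_app_iff_mem_essImage] at hX hY
  refine r.iPush.epi_of_epi_map ?_
  rw [← (IsIso.comp_inv_eq _).2 (r.iAdj'.counit_naturality f).symm]
  infer_instance

theorem isZero_rightDerived_iShriek_iPush [EnoughInjectives A] (Y : A') :
    IsZero ((r.iShriek.rightDerived 1).obj (r.iPush.obj Y)) := by
  let π := cokernel.π (Injective.ι (r.iPush.obj Y))
  have hS := shortExact_cokernel (Injective.ι (r.iPush.obj Y))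
  refine (isZero_rightDerived_one_iff_epi_map r.iShriek hS).2 ?_
  let c := r.iAdj'.counit.app (cokernel (Injective.ι (r.iPush.obj Y)))
  have sq := IsPullback.of_hasPullback π c
  have hT := shortExact_of_isPullback hS sq (sq.lift_fst _ 0 (by simp [π])) (sq.lift_snd _ _ _)
  have := hT.epi_g
  have h := r.jPull.kernel.prop_X₂_of_shortExact hT (r.isZero_jPull_iPush _)
    (r.isZero_jPull_iPush _)
  have := r.epi_iShriek_map h (r.isZero_jPull_iPush _) (pullback.snd π c)
  have w := r.iShriek.congr_map sq.w
  rw [Functor.map_comp, Functor.map_comp] at w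
  exact epi_of_epi_fac w

theorem isZero_rightDerived_iShriek_jPush [EnoughInjectives A] [EnoughInjectives A''] {Z : A''}
    (hZ : IsZero ((r.jPush.rightDerived 1).obj Z)) :
    IsZero ((r.iShriek.rightDerived 1).obj (r.jPush.obj Z)) := by
  have hS := shortExact_map_of_isZero_rightDerived_one r.jPush
    (shortExact_cokernel (Injective.ι Z)) hZ
  have : Injective ((ShortComplex.mk _ _ (cokernel.condition (Injective.ι Z))).map r.jPush).X₂ :=
    r.jAdj'.map_injective _ inferInstance
  exact (isZero_rightDerived_one_iff_epi_map r.iShriek hS).2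
    ⟨fun _ _ _ => (r.isZero_iShriek_jPush _).eq_of_src _ _⟩

end Ext

section Classes

variable {U' V' : ObjectProperty A'} {U'' V'' : ObjectProperty A''}

instance [EnoughProjectives A] [U'.IsStableUnderRetracts] [U''.IsStableUnderRetracts] :
    (r.classM U' U'').IsStableUnderRetracts where
  of_retract e hX := ⟨U'.prop_of_retract (e.map _) hX.1, U''.prop_of_retract (e.map _) hX.2.1,
    hX.2.2.of_mono (e.map (r.iPull.leftDerived 1)).i⟩

instance [EnoughInjectives A] [V'.IsStableUnderRetracts] [V''.IsStableUnderRetracts] :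
    (r.classN V' V'').IsStableUnderRetracts where
  of_retract e hY := ⟨V'.prop_of_retract (e.map _) hY.1, V''.prop_of_retract (e.map _) hY.2.1,
    hY.2.2.of_mono (e.map (r.iShriek.rightDerived 1)).i⟩

instance [EnoughInjectives A] [V'.IsClosedUnderExtensions] [V''.IsClosedUnderExtensions] :
    (r.classN V' V'').IsClosedUnderExtensions where
  prop_X₂_of_shortExact hS h₁ h₃ :=
    ⟨V'.prop_X₂_of_shortExact (shortExact_map_of_isZero_rightDerived_one r.iShriek hS h₁.2.2)
      h₁.1 h₃.1, V''.prop_X₂_of_shortExact (hS.map_of_exact r.jPull) h₁.2.1 h₃.2.1,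
      isZero_rightDerived_one_of_shortExact r.iShriek hS h₁.2.2 h₃.2.2⟩

theorem classN_of_injective [EnoughInjectives A] [EnoughProjectives A'']
    (h' : IsCotorsionPair U' V') (h'' : IsCotorsionPair U'' V'')
    (hL : ∀ X : A'', U'' X → IsZero ((r.jShriek.leftDerived 1).obj X)) (I : A) [Injective I] :
    r.classN V' V'' I := by
  have : Injective (r.iShriek.obj I) := r.iAdj'.map_injective _ inferInstance
  refine ⟨h'.right_of_injective _, ?_, r.iShriek.isZero_rightDerived_obj_injective_succ 0 I⟩
  rw [← h''.rightPerp_eq]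
  exact fun Z hZ => r.ext1Vanishes_jPull_of_injective I (hL Z hZ)

theorem classN_iPush [EnoughInjectives A] (h' : IsCotorsionPair U' V')
    (h'' : IsCotorsionPair U'' V'') {Y : A'} (hY : V' Y) : r.classN V' V'' (r.iPush.obj Y) :=
  have := h'.isStableUnderRetracts_right
  ⟨V'.prop_of_iso (asIso (r.iAdj'.unit.app Y)) hY, h''.right_of_isZero (r.isZero_jPull_iPush Y),
    r.isZero_rightDerived_iShriek_iPush Y⟩

theorem classN_jPush [EnoughInjectives A] [EnoughInjectives A''] (h' : IsCotorsionPair U' V')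
    (h'' : IsCotorsionPair U'' V'') {Z : A''} (hZ : V'' Z)
    (hR : IsZero ((r.jPush.rightDerived 1).obj Z)) : r.classN V' V'' (r.jPush.obj Z) :=
  have := h''.isStableUnderRetracts_right
  ⟨h'.right_of_isZero (r.isZero_iShriek_jPush Z),
    V''.prop_of_iso (asIso (r.jAdj'.counit.app Z)).symm hZ,
    r.isZero_rightDerived_iShriek_jPush hR⟩

theorem ext1Vanishes_of_classM_of_classN [EnoughProjectives A] [EnoughInjectives A]
    (hP : r.ConditionP) (h' : IsCotorsionPair U' V') (h'' : IsCotorsionPair U'' V'') {X Y : A}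
    (hX : r.classM U' U'' X) (hY : r.classN V' V'' Y) : Ext1Vanishes X Y :=
  ext1Vanishes_middle_left
    (r.shortExact_jCounit_iUnit ((r.isZero_leftDerived_iPull_iff hP X).1 hX.2.2))
    (r.ext1Vanishes_jShriek (h''.ext1Vanishes hX.2.1 hY.2.1))
    (r.ext1Vanishes_iPush hY.2.2 (h'.ext1Vanishes hX.1 hY.1))

theorem classM_kernel [EnoughProjectives A] [EnoughProjectives A''] (hP : r.ConditionP)
    (hU' : ∀ S : ShortComplex A', S.ShortExact → U' S.X₂ → U' S.X₃ → U' S.X₁)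
    (hU'' : ∀ S : ShortComplex A'', S.ShortExact → U'' S.X₂ → U'' S.X₃ → U'' S.X₁)
    (hL : ∀ X : A'', U'' X → IsZero ((r.jShriek.leftDerived 1).obj X))
    {S : ShortComplex A} (hS : S.ShortExact) (h₂ : r.classM U' U'' S.X₂)
    (h₃ : r.classM U' U'' S.X₃) : r.classM U' U'' S.X₁ := by
  have hj := hS.map_of_exact r.jPull
  refine ⟨hU' _ (shortExact_map_of_isZero_leftDerived_one r.iPull hS h₃.2.2) h₂.1 h₃.1,
    hU'' _ hj h₂.2.1 h₃.2.1, (r.isZero_leftDerived_iPull_iff hP _).2 ?_⟩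
  have : Mono (r.jShriek.map (r.jPull.map S.f)) :=
    (shortExact_map_of_isZero_leftDerived_one r.jShriek hj (hL _ h₃.2.1)).mono_f
  have : Mono (r.jCounit S.X₂) := (r.isZero_leftDerived_iPull_iff hP _).1 h₂.2.2
  exact r.mono_jCounit_of_mono_map S.f

end Classes

section Approximation

variable {U' V' : ObjectProperty A'} {U'' V'' : ObjectProperty A''}

theorem exists_epiWithKernel_jPull_mem [EnoughInjectives A] [EnoughInjectives A'']
    (h' : IsCotorsionPair U' V') (h'' : IsCompleteHereditaryCotorsionPair U'' V'')
    (hR : ∀ Y : A'', V'' Y → IsZero ((r.jPush.rightDerived 1).obj Y)) (M : A) :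
    ∃ (Y : A) (q : Y ⟶ M), epiWithKernel (r.classN V' V'') q ∧ U'' (r.jPull.obj Y) := by
  obtain ⟨W, g, ⟨Z, f, w, hS, hZ⟩, hW⟩ := h''.exists_epiWithKernel (r.jPull.obj M)
  let η : M ⟶ r.jPush.obj (r.jPull.obj M) := r.jAdj'.unit.app M
  have : IsIso (r.jPull.map η) := inferInstanceAs (IsIso (r.jPull.map (r.jAdj'.unit.app M)))
  have sq := IsPullback.of_hasPullback (r.jPush.map g) η
  have hT := shortExact_of_isPullback
    (shortExact_map_of_isZero_rightDerived_one r.jPush hS (hR Z hZ)) sq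
    (sq.lift_fst (r.jPush.map f) 0 (by simp [← Functor.map_comp, w])) (sq.lift_snd _ _ _)
  refine ⟨_, _, ⟨_, _, _, hT, r.classN_jPush h' h''.1 hZ (hR Z hZ)⟩, ?_⟩
  have := (sq.map r.jPull).isIso_fst_of_isIso
  have := h''.isStableUnderRetracts_left
  exact U''.prop_of_iso (asIso (r.jPull.map (pullback.fst (r.jPush.map g) η)) ≪≫
    asIso (r.jAdj'.counit.app W)).symm hW

/-- Push out a projective presentation `K ⟶ P ⟶ Y` along the composite of `K ⟶ i_* i^* K` with
`i_*` of a special `𝒱'`-preenvelope of `i^* K`. -/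
theorem exists_epiWithKernel_mono_jCounit [EnoughProjectives A] [EnoughInjectives A]
    (hP : r.ConditionP) (h' : IsCompleteHereditaryCotorsionPair U' V')
    (h'' : IsCotorsionPair U'' V'') (Y : A) :
    ∃ (X : A) (q : X ⟶ Y), epiWithKernel (r.classN V' V'') q ∧ IsIso (r.jPull.map q) ∧
      Mono (r.jCounit X) := by
  let k := kernel.ι (Projective.π Y)
  have hS := shortExact_kernel (Projective.π Y)
  obtain ⟨Z, W, f, g, w, hZW, -, hZ⟩ := h'.exists_right (r.iPull.obj (kernel (Projective.π Y)))
  have : Mono f := hZW.mono_f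
  let a := r.iUnit _ ≫ r.iPush.map f
  have sq := IsPushout.of_hasPushout k a
  have hT := shortExact_of_isPushout hS sq (sq.inl_desc (Projective.π Y) 0 (by simp [k]))
    (sq.inr_desc _ _ _)
  refine ⟨_, _, ⟨_, _, _, hT, r.classN_iPush h'.1 h'' hZ⟩,
    (hT.map_of_exact r.jPull).isIso_g_iff.2 (r.isZero_jPull_iPush Z), ?_⟩
  refine (r.mono_jCounit_iff (shortExact_biprod_of_isPushout sq)
    (r.mono_jCounit_biprod (hP _ inferInstance) Z)).2 ?_
  have := r.mono_iPull_map_iPush_map f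
  have hs : r.iPull.map (biprod.lift k (-a)) ≫ r.iPull.map (-biprod.snd) =
      r.iPull.map (r.iUnit _) ≫ r.iPull.map (r.iPush.map f) := by
    rw [← Functor.map_comp, ← Functor.map_comp]
    simp [a]
  have : IsIso (r.iPull.map (r.iUnit (kernel (Projective.π Y)))) :=
    inferInstanceAs (IsIso (r.iPull.map (r.iAdj.unit.app _)))
  exact mono_of_mono_fac hs

theorem exists_epiWithKernel_of_mono_jCounit [EnoughProjectives A] [EnoughInjectives A]
    (hP : r.ConditionP) (h' : IsCompleteHereditaryCotorsionPair U' V')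
    (h'' : IsCotorsionPair U'' V'') {Y : A} (hY : Mono (r.jCounit Y))
    (hY'' : U'' (r.jPull.obj Y)) :
    ∃ (X : A) (q : X ⟶ Y), epiWithKernel (r.classN V' V'') q ∧ r.classM U' U'' X := by
  obtain ⟨W, g, ⟨Z, f, w, hS, hZ⟩, hW⟩ := h'.exists_epiWithKernel (r.iPull.obj Y)
  have sq := IsPullback.of_hasPullback (r.iPush.map g) (r.iUnit Y)
  have hT := shortExact_of_isPullback (hS.map_of_exact r.iPush) sq
    (sq.lift_fst (r.iPush.map f) 0 (by simp [← Functor.map_comp, w])) (sq.lift_snd _ _ _)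
  have hQ := shortExact_of_isPullback (shortExact_kernel (r.iUnit Y)) sq.flip
    (sq.lift_snd 0 (kernel.ι (r.iUnit Y)) (by simp)) (sq.lift_fst _ _ _)
  have : IsIso (r.jPull.map (pullback.snd (r.iPush.map g) (r.iUnit Y))) :=
    (hT.map_of_exact r.jPull).isIso_g_iff.2 (r.isZero_jPull_iPush Z)
  have : IsIso (r.iPull.map (pullback.fst (r.iPush.map g) (r.iUnit Y))) :=
    have := hQ.epi_g
    isIso_map_g_of_isZero r.iPull hQ.exact (r.isZero_iPull_kernel_iUnit Y)
  have := h'.isStableUnderRetracts_left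
  have := h''.isStableUnderRetracts_left
  exact ⟨_, _, ⟨_, _, _, hT, r.classN_iPush h'.1 h'' hZ⟩,
    U'.prop_of_iso (asIso (r.iPull.map (pullback.fst (r.iPush.map g) (r.iUnit Y))) ≪≫
      asIso (r.iAdj.counit.app W)).symm hW,
    U''.prop_of_iso (asIso (r.jPull.map (pullback.snd (r.iPush.map g) (r.iUnit Y)))).symm hY'',
    (r.isZero_leftDerived_iPull_iff hP _).2
      (r.mono_jCounit_of_mono_map (pullback.snd (r.iPush.map g) (r.iUnit Y)))⟩

theorem exists_epiWithKernel_classM [EnoughProjectives A] [EnoughInjectives A]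
    [EnoughInjectives A''] (hP : r.ConditionP) (h' : IsCompleteHereditaryCotorsionPair U' V')
    (h'' : IsCompleteHereditaryCotorsionPair U'' V'')
    (hR : ∀ Y : A'', V'' Y → IsZero ((r.jPush.rightDerived 1).obj Y)) (M : A) :
    ∃ (X : A) (q : X ⟶ M), epiWithKernel (r.classN V' V'') q ∧ r.classM U' U'' X := by
  have := h''.isStableUnderRetracts_left
  have := h'.isClosedUnderExtensions_right
  have := h''.isClosedUnderExtensions_right
  obtain ⟨Y₁, q₁, hq₁, hY₁⟩ := r.exists_epiWithKernel_jPull_mem h'.1 h'' hR M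
  obtain ⟨Y₂, q₂, hq₂, _, hY₂⟩ := r.exists_epiWithKernel_mono_jCounit hP h' h''.1 Y₁
  obtain ⟨X, q₃, hq₃, hX⟩ := r.exists_epiWithKernel_of_mono_jCounit hP h' h''.1 hY₂
    (U''.prop_of_iso (asIso (r.jPull.map q₂)).symm hY₁)
  exact ⟨X, _, epiWithKernel_comp hq₃ (epiWithKernel_comp hq₂ hq₁), hX⟩

end Approximation

end Recollement

end RecollementGluing

theorem theorem3p12
    {A' : Type u₁} [Category.{v₁} A'] [Abelian A'] [EnoughProjectives A'] [EnoughInjectives A']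
    {A : Type u₂} [Category.{v₂} A] [Abelian A] [EnoughProjectives A] [EnoughInjectives A]
    {A'' : Type u₃} [Category.{v₃} A''] [Abelian A''] [EnoughProjectives A'']
    [EnoughInjectives A'']
    (r : RecollementGluing.Recollement A' A A'') (hP : r.ConditionP)
    (U' V' : ObjectProperty A') (U'' V'' : ObjectProperty A'')
    (h' : RecollementGluing.IsCompleteHereditaryCotorsionPair U' V')
    (h'' : RecollementGluing.IsCompleteHereditaryCotorsionPair U'' V'')
    (hL : ∀ X : A'', U'' X → IsZero ((r.jShriek.leftDerived 1).obj X))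
    (hR : ∀ Y : A'', V'' Y → IsZero ((r.jPush.rightDerived 1).obj Y)) :
    RecollementGluing.IsCompleteHereditaryCotorsionPair (r.classM U' U'') (r.classN V' V'') := by
  have := h'.isStableUnderRetracts_left
  have := h'.isStableUnderRetracts_right
  have := h'.isClosedUnderExtensions_right
  have := h''.isStableUnderRetracts_left
  have := h''.isStableUnderRetracts_right
  have := h''.isClosedUnderExtensions_right
  exact RecollementGluing.isCompleteHereditaryCotorsionPair_of_exists_epiWithKernel
    (r.classN_of_injective h'.1 h''.1 hL)
    (fun _ => r.classM_kernel hP h'.kernel_mem h''.kernel_mem hL)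
    (fun _ _ => r.ext1Vanishes_of_classM_of_classN hP h'.1 h''.1)
    (r.exists_epiWithKernel_classM hP h' h'' hR)
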